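/- Theorem 1. A cubic order is an integral domain $R$ that is free of rank $3$ as a $\mathbb{Z}$-module. Its discriminant is $\det(\mathrm{Tr}(\alpha_i\alpha_j)) \in \mathbb{Z}$, where $\alpha_1,\alpha_2,\alpha_3$ is any $\mathbb{Z}$-basis of $R$ and $\mathrm{Tr}(z)$ is the trace of the $\mathbb{Z}$-linear map $R \to R$, $w \mapsto zw$. For every real $X$, the number $N(X)$ of isomorphism classes of cubic orders whose ring automorphism group is isomorphic to a cyclic group of order $3$ and whose discriminant is less than $X$ is finite, and, as $X \to \infty$, $$ N(X) = \frac{\pi}{6\sqrt{3}}\, X^{1/2} + O(X^{1/4}). $$ -/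

import Mathlib

open Filter Asymptotics

/-- A cubic order: an integral domain that is free of rank 3 as a `ℤ`-module.
Every such ring is countable, so carriers in `Type` represent all isomorphism classes. -/
structure CubicOrder : Type 1 where
  carrier : Type
  [commRing : CommRing carrier]
  [isDomain : IsDomain carrier]
  [free : Module.Free ℤ carrier]
  finrank_eq : Module.finrank ℤ carrier = 3

namespace CubicOrder

attribute [instance] CubicOrder.commRing CubicOrder.isDomain CubicOrder.free

instance finite (R : CubicOrder) : Module.Finite ℤ R.carrier :=
  Module.finite_of_finrank_pos (by rw [R.finrank_eq]; norm_num)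

/-- The discriminant `det (Tr (αᵢ αⱼ))`, where `α` is a `ℤ`-basis and `Tr z` is the trace of
multiplication by `z`. It does not depend on the basis, see `disc_eq`. -/
noncomputable def disc (R : CubicOrder) : ℤ :=
  Algebra.discr ℤ (Module.finBasisOfFinrankEq ℤ R.carrier R.finrank_eq)

theorem disc_eq (R : CubicOrder) (b : Module.Basis (Fin 3) ℤ R.carrier) :
    R.disc = Algebra.discr ℤ b :=
  Algebra.discr_eq_discr R.carrier _ b

/-- The automorphism group of the ring is isomorphic to a cyclic group of order 3. -/
def HasAutC3 (R : CubicOrder) : Prop :=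
  Nonempty (RingAut R.carrier ≃* Multiplicative (ZMod 3))

/-- Isomorphism of cubic orders (as rings). -/
instance isoSetoid : Setoid CubicOrder where
  r R S := Nonempty (R.carrier ≃+* S.carrier)
  iseqv :=
    { refl := fun R => ⟨RingEquiv.refl R.carrier⟩
      symm := fun ⟨e⟩ => ⟨e.symm⟩
      trans := fun ⟨e⟩ ⟨f⟩ => ⟨e.trans f⟩ }

/-- The isomorphism classes of cubic orders with automorphism group cyclic of order 3 and with
discriminant less than `X`. -/
def c3Classes (X : ℝ) : Set (Quotient isoSetoid) :=
  Quotient.mk isoSetoid '' {R : CubicOrder | R.HasAutC3 ∧ (R.disc : ℝ) < X}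

end CubicOrder

/-! A nontrivial automorphism σ with σ³ = 1 of a cubic order R fixes only ℤ. So R/ℤ is a module of
rank one over the Euclidean ring ℤ[ω], with ω acting as σ, and hence is free. Lifting a generator to
α and shifting it by an integer gives a basis 1, α, σα with α·σα = qα - q². The integers q and t = α
+ σα + σ²α determine R, whose discriminant is (t² - 3qt + 9q²)² (`exists_isShanksBasis`,
`disc_of_isShanksBasis`). A generator is unique up to the six units of ℤ[ω] and σ is unique up to
inversion, so (q, t) is unique up to a group of order 4 (`parameters_eq`); the conditions q > 0 and
3q ≤ 2t select one point of each orbit.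

With X = T⁴ the pairs to count are the lattice points of the quarter ellipse (t - 3q/2)² + 27q²/4 <
T², whose area is πT²/(6√3); counting row by row costs O(T).

Pairs whose ring is not a domain must be removed. For them the characteristic cubic of α has an
integer root, which forces q = mab(a - b) and t = m(a³ - 3ab² + b³). Then t² - 3qt + 9q² = m²(a² -
ab + b²)³ ≥ m²|ab|³, so their number is at most a constant times T Σ (ab)^(-3/2) = O(T). -/

/-! ### Shanks rings -/

/-- The ring with `ℤ`-basis `1, α, β` and multiplication table `α² = (2q² - qt) + tα + qβ`,
`αβ = -q² + qα`, `β² = 2q² - qα + (t - q)β`. It has an automorphism of order 3 that sends `α` to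
`β` and `β` to `t - α - β`. -/
@[ext]
structure ShanksRing (q t : ℤ) where
  coeffOne : ℤ
  coeffα : ℤ
  coeffβ : ℤ

namespace ShanksRing

variable {q t : ℤ}

instance : Zero (ShanksRing q t) := ⟨⟨0, 0, 0⟩⟩
instance : One (ShanksRing q t) := ⟨⟨1, 0, 0⟩⟩
instance : Add (ShanksRing q t) :=
  ⟨fun x y => ⟨x.1 + y.1, x.2 + y.2, x.3 + y.3⟩⟩
instance : Neg (ShanksRing q t) := ⟨fun x => ⟨-x.1, -x.2, -x.3⟩⟩
instance : Sub (ShanksRing q t) :=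
  ⟨fun x y => ⟨x.1 - y.1, x.2 - y.2, x.3 - y.3⟩⟩
instance : SMul ℕ (ShanksRing q t) := ⟨fun n x => ⟨n * x.1, n * x.2, n * x.3⟩⟩
instance : SMul ℤ (ShanksRing q t) := ⟨fun n x => ⟨n * x.1, n * x.2, n * x.3⟩⟩
instance : NatCast (ShanksRing q t) := ⟨fun n => ⟨n, 0, 0⟩⟩
instance : IntCast (ShanksRing q t) := ⟨fun n => ⟨n, 0, 0⟩⟩
instance : Mul (ShanksRing q t) :=
  ⟨fun x y =>
    ⟨x.1 * y.1 + x.2 * y.2 * (2 * q ^ 2 - q * t) - (x.2 * y.3 + x.3 * y.2) * q ^ 2 +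
        x.3 * y.3 * (2 * q ^ 2),
      x.1 * y.2 + x.2 * y.1 + x.2 * y.2 * t + (x.2 * y.3 + x.3 * y.2) * q - x.3 * y.3 * q,
      x.1 * y.3 + x.3 * y.1 + x.2 * y.2 * q + x.3 * y.3 * (t - q)⟩⟩

theorem zero_def : (0 : ShanksRing q t) = ⟨0, 0, 0⟩ := rfl
theorem one_def : (1 : ShanksRing q t) = ⟨1, 0, 0⟩ := rfl
theorem add_def (x y : ShanksRing q t) : x + y = ⟨x.1 + y.1, x.2 + y.2, x.3 + y.3⟩ := rfl
theorem neg_def (x : ShanksRing q t) : -x = ⟨-x.1, -x.2, -x.3⟩ := rfl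
theorem sub_def (x y : ShanksRing q t) : x - y = ⟨x.1 - y.1, x.2 - y.2, x.3 - y.3⟩ := rfl
theorem nsmul_def (n : ℕ) (x : ShanksRing q t) : n • x = ⟨n * x.1, n * x.2, n * x.3⟩ := rfl
theorem zsmul_def (n : ℤ) (x : ShanksRing q t) : n • x = ⟨n * x.1, n * x.2, n * x.3⟩ := rfl
theorem natCast_def (n : ℕ) : (n : ShanksRing q t) = ⟨n, 0, 0⟩ := rfl
theorem intCast_def (n : ℤ) : (n : ShanksRing q t) = ⟨n, 0, 0⟩ := rfl
theorem mul_def (x y : ShanksRing q t) : x * y =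
    ⟨x.1 * y.1 + x.2 * y.2 * (2 * q ^ 2 - q * t) - (x.2 * y.3 + x.3 * y.2) * q ^ 2 +
        x.3 * y.3 * (2 * q ^ 2),
      x.1 * y.2 + x.2 * y.1 + x.2 * y.2 * t + (x.2 * y.3 + x.3 * y.2) * q - x.3 * y.3 * q,
      x.1 * y.3 + x.3 * y.1 + x.2 * y.2 * q + x.3 * y.3 * (t - q)⟩ := rfl

instance : CommRing (ShanksRing q t) where
  add_assoc x y z := by simp only [add_def]; ext <;> ring
  zero_add x := by simp only [add_def, zero_def]; ext <;> ring
  add_zero x := by simp only [add_def, zero_def]; ext <;> ring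
  add_comm x y := by simp only [add_def]; ext <;> ring
  left_distrib x y z := by simp only [add_def, mul_def]; ext <;> ring
  right_distrib x y z := by simp only [add_def, mul_def]; ext <;> ring
  zero_mul x := by simp only [mul_def, zero_def]; ext <;> ring
  mul_zero x := by simp only [mul_def, zero_def]; ext <;> ring
  mul_assoc x y z := by simp only [mul_def]; ext <;> ring
  one_mul x := by simp only [mul_def, one_def]; ext <;> ring
  mul_one x := by simp only [mul_def, one_def]; ext <;> ring
  mul_comm x y := by simp only [mul_def]; ext <;> ring
  neg_add_cancel x := by simp only [add_def, neg_def, zero_def]; ext <;> ring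
  sub_eq_add_neg x y := by simp only [sub_def, add_def, neg_def]; ext <;> ring
  nsmul n x := n • x
  nsmul_zero x := by simp only [nsmul_def, zero_def]; ext <;> simp
  nsmul_succ n x := by simp only [nsmul_def, add_def]; ext <;> push_cast <;> ring
  zsmul n x := n • x
  zsmul_zero' x := by simp only [zsmul_def, zero_def]; ext <;> ring
  zsmul_succ' n x := by simp only [zsmul_def, add_def]; ext <;> push_cast <;> ring
  zsmul_neg' n x := by
    simp only [zsmul_def, neg_def]; ext <;> simp only [Int.negSucc_eq] <;> push_cast <;> ring
  natCast_zero := by simp only [natCast_def, zero_def]; rfl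
  natCast_succ n := by simp only [natCast_def, one_def, add_def]; ext <;> simp
  intCast_ofNat n := rfl
  intCast_negSucc n := by
    simp only [intCast_def, natCast_def, neg_def]; ext <;> simp [Int.negSucc_eq]

/-- The coordinates with respect to `1, α, β`. -/
def equivFun (q t : ℤ) : ShanksRing q t ≃ₗ[ℤ] (Fin 3 → ℤ) where
  toFun x := ![x.1, x.2, x.3]
  invFun v := ⟨v 0, v 1, v 2⟩
  left_inv x := rfl
  right_inv v := by ext i; fin_cases i <;> rfl
  map_add' x y := by ext i; fin_cases i <;> rfl
  map_smul' n x := by ext i; fin_cases i <;> rfl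

/-- The basis `1, α, β`. -/
noncomputable def basis (q t : ℤ) : Module.Basis (Fin 3) ℤ (ShanksRing q t) :=
  Module.Basis.ofEquivFun (equivFun q t)

theorem basis_zero : basis q t 0 = ⟨1, 0, 0⟩ := by
  simp only [basis, Module.Basis.coe_ofEquivFun]; rfl

theorem basis_one : basis q t 1 = ⟨0, 1, 0⟩ := by
  simp only [basis, Module.Basis.coe_ofEquivFun]; rfl

theorem basis_two : basis q t 2 = ⟨0, 0, 1⟩ := by
  simp only [basis, Module.Basis.coe_ofEquivFun]; rfl

instance : Module.Free ℤ (ShanksRing q t) := Module.Free.of_basis (basis q t)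

theorem finrank_eq : Module.finrank ℤ (ShanksRing q t) = 3 := by
  simpa using Module.finrank_eq_card_basis (basis q t)

theorem trace_eq (x : ShanksRing q t) :
    Algebra.trace ℤ (ShanksRing q t) x = 3 * x.1 + t * x.2 + t * x.3 := by
  rw [Algebra.trace_eq_matrix_trace (basis q t), Matrix.trace, Fin.sum_univ_three]
  have h (y : ShanksRing q t) (i : Fin 3) : (basis q t).repr y i = ![y.1, y.2, y.3] i := rfl
  simp only [Matrix.diag, Algebra.leftMulMatrix_eq_repr_mul, h, basis_zero, basis_one, basis_two,
    mul_def]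
  simp
  ring

theorem discr_basis :
    Algebra.discr ℤ (basis q t) = (t ^ 2 - 3 * q * t + 9 * q ^ 2) ^ 2 := by
  rw [Algebra.discr_def, Matrix.det_fin_three]
  simp only [Algebra.traceMatrix_apply, Algebra.traceForm_apply, basis_zero, basis_one, basis_two,
    trace_eq, mul_def]
  ring

/-- The ring homomorphism that is determined by the images of `α` and `β`. -/
def lift {S : Type*} [CommRing S] (α β : S)
    (hα : α ^ 2 = t * α + q * β + (2 * q ^ 2 - q * t)) (hαβ : α * β = q * α - q ^ 2)
    (hβ : β ^ 2 = 2 * q ^ 2 - q * α + (t - q) * β) : ShanksRing q t →+* S where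
  toFun x := x.1 + x.2 * α + x.3 * β
  map_zero' := by simp [zero_def]
  map_one' := by simp [one_def]
  map_add' x y := by simp only [add_def]; push_cast; ring
  map_mul' x y := by
    simp only [mul_def]; push_cast
    linear_combination (-x.2 * y.2 : S) * hα - (x.2 * y.3 + x.3 * y.2 : S) * hαβ
      - (x.3 * y.3 : S) * hβ

/-- The automorphism `α ↦ β ↦ t - α - β`. -/
def rotate (q t : ℤ) : ShanksRing q t ≃+* ShanksRing q t where
  toFun x := ⟨x.1 + x.3 * t, -x.3, x.2 - x.3⟩
  invFun x := ⟨x.1 + x.2 * t, x.3 - x.2, -x.2⟩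
  left_inv x := by ext <;> simp
  right_inv x := by ext <;> simp
  map_add' x y := by simp only [add_def]; ext <;> dsimp only <;> ring
  map_mul' x y := by simp only [mul_def]; ext <;> dsimp only <;> ring

end ShanksRing

/-! ### Shanks bases and the uniqueness of their parameters -/

/-- `1, α, σ α` is a `ℤ`-basis of `R` with `α * σ α = q α - q²`, and `α` has trace `t`
with respect to the automorphism `σ` (which is then of order 3). -/
structure IsShanksBasis {R : Type*} [CommRing R] (σ : R ≃+* R) (α : R) (q t : ℤ) : Prop where
  span : ∀ x : R, ∃ a b c : ℤ, x = a + b * α + c * σ α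
  indep : ∀ a b c : ℤ, (a + b * α + c * σ α : R) = 0 → a = 0 ∧ b = 0 ∧ c = 0
  mul : α * σ α = q * α - q ^ 2
  tr : α + σ α + σ (σ α) = t

theorem ShanksRing.isShanksBasis (q t : ℤ) :
    IsShanksBasis (ShanksRing.rotate q t) ⟨0, 1, 0⟩ q t where
  span x := ⟨x.1, x.2, x.3, by
    simp only [rotate, RingEquiv.coe_mk, Equiv.coe_fn_mk, intCast_def, mul_def, add_def]
    ext <;> simp⟩
  indep a b c h := by
    simp only [rotate, RingEquiv.coe_mk, Equiv.coe_fn_mk, intCast_def, mul_def, add_def,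
      zero_def, ShanksRing.mk.injEq] at h
    simpa using h
  mul := by
    simp only [rotate, RingEquiv.coe_mk, Equiv.coe_fn_mk, intCast_def, mul_def, sub_def, pow_two]
    ext <;> simp
  tr := by
    simp only [rotate, RingEquiv.coe_mk, Equiv.coe_fn_mk, intCast_def, add_def]
    ext <;> simp

namespace IsShanksBasis

variable {R : Type*} [CommRing R] {σ : R ≃+* R} {α : R} {q t : ℤ}

theorem apply_apply (h : IsShanksBasis σ α q t) : σ (σ α) = t - α - σ α := by
  linear_combination h.tr

theorem apply_apply_apply (h : IsShanksBasis σ α q t) : σ (σ (σ α)) = α := by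
  have := congrArg σ h.tr
  simp only [map_add, map_intCast] at this
  linear_combination this - h.tr

theorem mul_sq (h : IsShanksBasis σ α q t) :
    σ α * σ (σ α) = q * σ α - q ^ 2 := by
  simpa using congrArg σ h.mul

theorem sq_mul (h : IsShanksBasis σ α q t) :
    σ (σ α) * α = q * σ (σ α) - q ^ 2 := by
  simpa [h.apply_apply_apply] using congrArg σ h.mul_sq

theorem sq_eq (h : IsShanksBasis σ α q t) :
    α ^ 2 = t * α + q * σ α + (2 * q ^ 2 - q * t) := by
  linear_combination (α - q) * h.tr - h.mul - h.sq_mul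

theorem apply_sq_eq (h : IsShanksBasis σ α q t) :
    (σ α) ^ 2 = 2 * q ^ 2 - q * α + (t - q) * σ α := by
  have := congrArg σ h.sq_eq
  simp only [map_pow, map_add, map_mul, map_intCast, map_sub, map_ofNat, h.apply_apply] at this
  linear_combination this

/-- A ring with a Shanks basis is a Shanks ring. -/
noncomputable def equiv (h : IsShanksBasis σ α q t) : ShanksRing q t ≃+* R :=
  RingEquiv.ofBijective
    (ShanksRing.lift α (σ α) h.sq_eq h.mul h.apply_sq_eq)
    ⟨by
      rw [injective_iff_map_eq_zero]
      intro x hx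
      obtain ⟨h₁, h₂, h₃⟩ := h.indep _ _ _ hx
      exact ShanksRing.ext h₁ h₂ h₃,
    fun x => by
      obtain ⟨a, b, c, rfl⟩ := h.span x
      exact ⟨⟨a, b, c⟩, rfl⟩⟩

theorem map {S : Type*} [CommRing S] (h : IsShanksBasis σ α q t) (e : R ≃+* S) :
    IsShanksBasis (e.symm.trans (σ.trans e)) (e α) q t where
  span x := by
    obtain ⟨a, b, c, hx⟩ := h.span (e.symm x)
    refine ⟨a, b, c, e.symm.injective ?_⟩
    simpa using hx
  indep a b c hx := h.indep a b c <| e.injective <| by simpa using hx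
  mul := by simpa using congrArg e h.mul
  tr := by simpa using congrArg e h.tr

theorem neg (h : IsShanksBasis σ α q t) : IsShanksBasis σ (-α) (-q) (-t) where
  span x := by
    obtain ⟨a, b, c, rfl⟩ := h.span x
    exact ⟨a, -b, -c, by simp⟩
  indep a b c hx := by
    have := h.indep a (-b) (-c) (by rw [← hx, map_neg]; push_cast; ring)
    simpa using this
  mul := by rw [map_neg]; push_cast; linear_combination h.mul
  tr := by simp only [map_neg]; push_cast; linear_combination -h.tr

theorem apply (h : IsShanksBasis σ α q t) : IsShanksBasis σ (σ α) q t where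
  span x := by
    obtain ⟨a, b, c, rfl⟩ := h.span x
    refine ⟨a + b * t, c - b, -b, ?_⟩
    push_cast
    linear_combination (b : R) * h.tr
  indep a b c hx := by
    have := h.indep (a + c * t) (-c) (b - c) (by
      push_cast
      linear_combination hx - (c : R) * h.tr)
    obtain ⟨h₁, h₂, h₃⟩ := this
    obtain rfl : c = 0 := by omega
    refine ⟨by simpa using h₁, by omega, rfl⟩
  mul := h.mul_sq
  tr := by rw [h.apply_apply_apply, ← h.tr]; ring

/-- From σ²α·α = qσ²α - q² follows (α - q)(σ⁻¹α - q) = -qα = -q(α - q) - q², so reversing σ only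
requires a shift by q. -/
theorem symm (h : IsShanksBasis σ α q t) : IsShanksBasis σ.symm (α - q) (-q) (t - 3 * q) := by
  have hs : σ.symm α = σ (σ α) := by rw [RingEquiv.symm_apply_eq, h.apply_apply_apply]
  have hs' : σ.symm (σ (σ α)) = σ α := by simp
  refine ⟨fun x => ?_, fun a b c hx => ?_, ?_, ?_⟩
  · obtain ⟨a, b, c, rfl⟩ := h.span x
    refine ⟨a + b * q + c * t - 2 * c * q, b - c, -c, ?_⟩
    simp only [map_sub, map_intCast, hs]
    push_cast
    linear_combination (c : R) * h.tr
  · simp only [map_sub, map_intCast, hs] at hx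
    have := h.indep (a - b * q - c * q + c * t) (b - c) (-c) (by
      push_cast
      linear_combination hx - (c : R) * h.tr)
    obtain ⟨h₁, h₂, h₃⟩ := this
    obtain rfl : c = 0 := by omega
    obtain rfl : b = 0 := by omega
    simpa using h₁
  · simp only [map_sub, map_intCast, hs]
    push_cast
    linear_combination h.sq_mul
  · simp only [map_sub, map_intCast, hs, hs']
    push_cast
    linear_combination h.tr

/-- Shanks bases for the same automorphism that differ by an integer are equal. -/
theorem eq_of_add (h : IsShanksBasis σ α q t) {n q' t' : ℤ}
    (h' : IsShanksBasis σ (α + n) q' t') : q' = q ∧ t' = t := by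
  have hm := h'.mul
  have ht := h'.tr
  simp only [map_add, map_intCast] at hm ht
  -- Expanding (α + n)(σα + n), the coefficient of σα is n, while a Shanks basis requires 0.
  obtain ⟨h₁, h₂, h₃⟩ := h.indep (n ^ 2 - q ^ 2 - q' * n + q' ^ 2) (q + n - q') n (by
    push_cast
    linear_combination hm - h.mul)
  obtain rfl := h₃
  refine ⟨by omega, ?_⟩
  have := h.indep (t - t') 0 0 (by push_cast; push_cast at ht; linear_combination ht - h.tr)
  omega

/-- These are the six units of ℤ[ω], where x + yω has norm x² - xy + y². -/
theorem sq_sub_mul_add_sq_eq_one {x y : ℤ} (h : IsUnit (x ^ 2 - x * y + y ^ 2)) :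
    (x = 1 ∧ y = 0) ∨ (x = -1 ∧ y = 0) ∨ (x = 0 ∧ y = 1) ∨ (x = 0 ∧ y = -1) ∨
      (x = 1 ∧ y = 1) ∨ (x = -1 ∧ y = -1) := by
  have h1 : x ^ 2 - x * y + y ^ 2 = 1 := by
    rcases Int.isUnit_iff.1 h with h | h
    · exact h
    · nlinarith [sq_nonneg (x - y), sq_nonneg x, sq_nonneg y]
  have hx : x ^ 2 ≤ 1 := by nlinarith [sq_nonneg (x - 2 * y)]
  have hy : y ^ 2 ≤ 1 := by nlinarith [sq_nonneg (y - 2 * x)]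
  have hx₁ : x ≤ 1 := by nlinarith
  have hx₂ : -1 ≤ x := by nlinarith
  have hy₁ : y ≤ 1 := by nlinarith
  have hy₂ : -1 ≤ y := by nlinarith
  interval_cases x <;> interval_cases y <;> simp_all

/-- Modulo ℤ both α and α' generate R/ℤ over ℤ[ω], so they differ by a unit ±ωⁱ. Multiplication by ω
is σ, which preserves (q, t), and -1 negates both. -/
theorem eq_or_eq_neg (h : IsShanksBasis σ α q t) {α' : R} {q' t' : ℤ}
    (h' : IsShanksBasis σ α' q' t') : (q' = q ∧ t' = t) ∨ (q' = -q ∧ t' = -t) := by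
  obtain ⟨n, x, y, hα'⟩ := h.span α'
  obtain ⟨n', x', y', hα⟩ := h'.span α
  have hσ : σ α' = (n + y * t : ℤ) + (-y : ℤ) * α + (x - y : ℤ) * σ α := by
    rw [hα']
    simp only [map_add, map_mul, map_intCast]
    push_cast
    linear_combination (y : R) * h.tr
  -- The last two entries are the coordinates of (x' + y'ω)(x + yω) - 1 in ℤ[ω].
  have hu := h.indep (n' + x' * n + y' * (n + y * t)) (x' * x - y' * y - 1)
      (x' * y + y' * (x - y)) (by
    push_cast
    rw [hσ, hα'] at hα
    push_cast at hα
    linear_combination -hα)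
  have hunit : IsUnit (x ^ 2 - x * y + y ^ 2) := by
    refine IsUnit.of_mul_eq_one (x' ^ 2 - x' * y' + y' ^ 2) ?_
    have h₂ : x' * x - y' * y = 1 := by omega
    have h₃ := hu.2.2
    have h₄ : (x' * x - y' * y) ^ 2 - (x' * x - y' * y) * (x' * y + y' * (x - y)) +
      (x' * y + y' * (x - y)) ^ 2 = 1 := by rw [h₂, h₃]; ring
    linear_combination h₄
  have key (β : R) (m : ℤ) (hβ : IsShanksBasis σ β q t) (hm : α' = β + m ∨ α' = -β + m) :
      (q' = q ∧ t' = t) ∨ (q' = -q ∧ t' = -t) := by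
    rcases hm with rfl | rfl
    · exact Or.inl (hβ.eq_of_add h')
    · exact Or.inr (hβ.neg.eq_of_add h')
  have e := h.apply_apply
  rcases sq_sub_mul_add_sq_eq_one hunit with ⟨rfl, rfl⟩ | ⟨rfl, rfl⟩ | ⟨rfl, rfl⟩ | ⟨rfl, rfl⟩ |
    ⟨rfl, rfl⟩ | ⟨rfl, rfl⟩ <;> push_cast at hα'
  · exact key α n h (Or.inl (by linear_combination hα'))
  · exact key α n h (Or.inr (by linear_combination hα'))
  · exact key (σ α) n h.apply (Or.inl (by linear_combination hα'))
  · exact key (σ α) n h.apply (Or.inr (by linear_combination hα'))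
  · exact key _ (n + t) h.apply.apply (Or.inr (by push_cast; linear_combination hα' + e))
  · exact key _ (n - t) h.apply.apply (Or.inl (by push_cast; linear_combination hα' - e))

theorem intCast_injective (h : IsShanksBasis σ α q t) :
    Function.Injective (Int.cast : ℤ → R) := by
  refine (injective_iff_map_eq_zero (Int.castRingHom R)).2 fun a ha => ?_
  exact (h.indep a 0 0 (by simpa using ha)).1

theorem apply_ne (h : IsShanksBasis σ α q t) : σ α ≠ α := fun h0 => by
  simpa using h.indep 0 (-1) 1 (by rw [h0]; simp)

theorem symm_apply_ne (h : IsShanksBasis σ α q t) : σ.symm α ≠ α := fun h0 => by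
  rw [RingEquiv.symm_apply_eq] at h0
  exact h.apply_ne h0.symm

theorem symm_apply_ne_apply (h : IsShanksBasis σ α q t) : σ.symm α ≠ σ α := fun h0 => by
  rw [RingEquiv.symm_apply_eq] at h0
  have := congrArg σ h0
  rw [h.apply_apply_apply] at this
  exact h.apply_ne this

variable [IsDomain R]

theorem ne_zero (h : IsShanksBasis σ α q t) : q ≠ 0 := by
  rintro rfl
  have h0 := h.mul
  simp only [Int.cast_zero, zero_mul, ne_eq, OfNat.ofNat_ne_zero, not_false_eq_true, zero_pow,
    sub_zero, mul_eq_zero, EmbeddingLike.map_eq_zero_iff, or_self] at h0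
  simpa using h.indep 0 1 0 (by simp [h0])

/-- An automorphism permutes the roots α, σα, σ²α = σ⁻¹α of the characteristic cubic of α. It is
determined by the image of α, since qσα is a polynomial in α and q ≠ 0. -/
theorem ringEquiv_eq (h : IsShanksBasis σ α q t) (τ : R ≃+* R) :
    τ = 1 ∨ τ = σ ∨ τ = σ.symm := by
  have ext (ρ : R ≃+* R) (hα : τ α = ρ α) : τ = ρ := by
    have h2 (ρ : R ≃+* R) :
        (q : R) * ρ (σ α) = ρ α ^ 2 - t * ρ α - (2 * q ^ 2 - q * t) := by
      have := congrArg ρ h.sq_eq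
      simp only [map_pow, map_add, map_mul, map_intCast, map_sub, map_ofNat] at this
      linear_combination -this
    have hq : (q : R) ≠ 0 := fun h0 => h.ne_zero (h.intCast_injective (by simpa using h0))
    have hβ : τ (σ α) = ρ (σ α) := mul_left_cancel₀ hq (by rw [h2, h2, hα])
    ext x
    obtain ⟨a, b, c, rfl⟩ := h.span x
    simp only [map_add, map_mul, map_intCast, hα, hβ]
  have h3 (x : R) : (x - α) * (x - σ α) * (x - σ (σ α)) =
      x ^ 3 - t * x ^ 2 + (q * t - 3 * q ^ 2) * x + q ^ 3 := by
    linear_combination (-x ^ 2 + q * x) * h.tr + x * (h.mul + h.mul_sq + h.sq_mul) -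
      σ (σ α) * h.mul - q * h.sq_mul
  have h4 := h3 (τ α)
  have h5 := congrArg τ (h3 α)
  simp only [map_add, map_mul, map_intCast, map_pow, map_sub, map_ofNat, sub_self, zero_mul,
    map_zero] at h5
  rw [← h5, mul_eq_zero, mul_eq_zero, sub_eq_zero, sub_eq_zero, sub_eq_zero] at h4
  rcases h4 with (h4 | h4) | h4
  · exact Or.inl (ext 1 h4)
  · exact Or.inr (Or.inl (ext σ h4))
  · refine Or.inr (Or.inr (ext σ.symm ?_))
    rw [h4, eq_comm, RingEquiv.symm_apply_eq, h.apply_apply_apply]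

theorem natCard_ringAut (h : IsShanksBasis σ α q t) : Nat.card (RingAut R) = 3 := by
  have h1 : (1 : RingAut R) ≠ σ := fun h0 => h.apply_ne (by rw [← h0]; rfl)
  have h2 : (1 : RingAut R) ≠ σ.symm := fun h0 => h.symm_apply_ne (by rw [← h0]; rfl)
  have h3 : (σ : RingAut R) ≠ σ.symm := fun h0 => h.symm_apply_ne_apply (by rw [← h0])
  have hu : (Set.univ : Set (RingAut R)) = {1, σ, σ.symm} :=
    (Set.eq_univ_of_forall fun τ => h.ringEquiv_eq τ).symm
  rw [← Set.ncard_univ, hu]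
  exact Set.ncard_eq_three.2 ⟨_, _, _, h1, h2, h3, rfl⟩

theorem nonempty_ringAut_equiv (h : IsShanksBasis σ α q t) :
    Nonempty (RingAut R ≃* Multiplicative (ZMod 3)) :=
  have : Fact (Nat.Prime 3) := ⟨Nat.prime_three⟩
  ⟨mulEquivOfPrimeCardEq (p := 3) h.natCard_ringAut (by simp)⟩

/-- The parameters of a Shanks basis are unique up to the action of a group of order 4. -/
theorem parameters_eq (h : IsShanksBasis σ α q t) {σ' : R ≃+* R} {α' : R} {q' t' : ℤ}
    (h' : IsShanksBasis σ' α' q' t') :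
    (q' = q ∧ (t' = t ∨ t' = 3 * q - t)) ∨ (q' = -q ∧ (t' = -t ∨ t' = t - 3 * q)) := by
  rcases h.ringEquiv_eq σ' with rfl | rfl | rfl
  · exact absurd rfl h'.apply_ne
  · rcases h.eq_or_eq_neg h' with h | h <;> omega
  · rcases h.symm.eq_or_eq_neg h' with h | h <;> omega

theorem exists_normalized (h : IsShanksBasis σ α q t) :
    ∃ (σ' : R ≃+* R) (α' : R) (q' t' : ℤ), IsShanksBasis σ' α' q' t' ∧ 0 < q' ∧
      3 * q' ≤ 2 * t' := by
  have hq := h.ne_zero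
  rcases lt_or_gt_of_ne hq with hq | hq <;> rcases le_total (3 * q) (2 * t) with ht | ht
  · exact ⟨_, _, _, _, h.symm, by omega, by omega⟩
  · exact ⟨_, _, _, _, h.neg, by omega, by omega⟩
  · exact ⟨_, _, _, _, h, by omega, by omega⟩
  · exact ⟨_, _, _, _, h.symm.neg, by omega, by omega⟩

end IsShanksBasis

/-! ### Existence of a Shanks basis -/

theorem Int.exists_two_mul_abs_le (x : ℤ) {k : ℤ} (hk : k ≠ 0) :
    ∃ y z : ℤ, x = k * y + z ∧ 2 * |z| ≤ |k| := by
  have h₁ := Int.emod_nonneg x hk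
  have h₂ := Int.emod_lt_abs x hk
  have h₃ := Int.mul_ediv_add_emod x k
  by_cases h : 2 * (x % k) ≤ |k|
  · exact ⟨x / k, x % k, h₃.symm, by rwa [abs_of_nonneg h₁]⟩
  · refine ⟨x / k + k.sign, x % k - |k|, ?_, ?_⟩
    · rw [mul_add, Int.mul_sign_self, ← Int.natCast_natAbs]
      linear_combination -h₃
    · rw [abs_of_nonpos (by omega)]; omega

section FreeDomain

variable {R : Type*} [CommRing R] [Module.Free ℤ R]

theorem exists_relation_of_finrank_eq_three (hr : Module.finrank ℤ R = 3) (x y z w : R) :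
    ∃ a b c d : ℤ, (a * x + b * y + c * z + d * w : R) = 0 ∧
      ¬(a = 0 ∧ b = 0 ∧ c = 0 ∧ d = 0) := by
  have : Module.Finite ℤ R := Module.finite_of_finrank_pos (by omega)
  have h : ¬LinearIndependent ℤ ![x, y, z, w] := fun h => by
    simpa [hr] using h.fintype_card_le_finrank
  obtain ⟨g, hg, i, hi⟩ := Fintype.not_linearIndependent_iff.1 h
  refine ⟨g 0, g 1, g 2, g 3, by simpa [Fin.sum_univ_four] using hg, fun h => hi ?_⟩
  fin_cases i <;> simp [h]

variable [IsDomain R]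

theorem intCast_injective_of_free : Function.Injective (Int.cast : ℤ → R) := by
  refine (injective_iff_map_eq_zero (Int.castRingHom R)).2 fun a ha => ?_
  have : a • (1 : R) = 0 := by simpa using ha
  exact (smul_eq_zero_iff_left one_ne_zero).1 this

theorem IsIntegral.exists_eq_intCast {K : Type*} [Field K] [CharZero K] {x : K}
    (hx : IsIntegral ℤ x) {r : ℚ} (h : x = r) : ∃ k : ℤ, x = k := by
  have he : x = algebraMap ℚ K r := by simpa using h
  rw [he, isIntegral_algebraMap_iff (algebraMap ℚ K).injective] at hx
  obtain ⟨k, hk⟩ := IsIntegrallyClosed.isIntegral_iff.1 hx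
  exact ⟨k, by rw [he, ← hk]; simp⟩

/-- In the fraction field x is the rational number m/n; it is integral over ℤ, which is integrally
closed. -/
theorem exists_eq_intCast_of_mul_eq [Module.Finite ℤ R] {x : R} {n m : ℤ} (hn : n ≠ 0)
    (h : (n * x : R) = m) : ∃ k : ℤ, x = k := by
  have hc : CharZero R := charZero_of_injective_algebraMap (R := ℤ) intCast_injective_of_free
  obtain ⟨p, hp, hpx⟩ := Algebra.IsIntegral.isIntegral (R := ℤ) x
  have hpx' := congrArg (algebraMap R (FractionRing R)) hpx
  rw [Polynomial.hom_eval₂, map_zero, Subsingleton.elim (RingHom.comp _ _)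
    (Int.castRingHom (FractionRing R))] at hpx'
  have he : algebraMap R (FractionRing R) x = ((m / n : ℚ) : FractionRing R) := by
    have := congrArg (algebraMap R (FractionRing R)) h
    simp only [map_mul, map_intCast] at this
    have hn' : (n : FractionRing R) ≠ 0 := by exact_mod_cast hn
    push_cast
    rw [eq_div_iff hn']
    linear_combination this
  obtain ⟨k, hk⟩ := IsIntegral.exists_eq_intCast (K := FractionRing R) ⟨p, hp, hpx'⟩ he
  refine ⟨k, IsFractionRing.injective R (FractionRing R) ?_⟩
  rw [map_intCast]
  exact hk

variable {σ : R ≃+* R}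

/-- If y is moved by σ, rank 3 forces a relation (a + bx) + (c + dx)y = 0. Subtracting its image
under σ gives c + dx = 0, hence also a + bx = 0; one of the two is nontrivial and makes x rational.
-/
theorem exists_eq_intCast_of_fixed (hr : Module.finrank ℤ R = 3) (hσ : σ ≠ 1) {x : R}
    (hx : σ x = x) : ∃ k : ℤ, x = k := by
  have : Module.Finite ℤ R := Module.finite_of_finrank_pos (by omega)
  obtain ⟨y, hy⟩ : ∃ y, σ y ≠ y := by
    by_contra! h
    exact hσ (RingEquiv.ext h)
  have rat {a b : ℤ} (h : (a + b * x : R) = 0) (hab : ¬(a = 0 ∧ b = 0)) : ∃ k : ℤ, x = k := by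
    refine exists_eq_intCast_of_mul_eq (n := b) (m := -a) ?_ (by push_cast; linear_combination h)
    rintro rfl
    refine hab ⟨intCast_injective_of_free (R := R) (by simpa using h), rfl⟩
  obtain ⟨a, b, c, d, h, h0⟩ := exists_relation_of_finrank_eq_three hr 1 x y (x * y)
  have h' := congrArg σ h
  simp only [map_add, map_mul, map_intCast, map_one, hx, map_zero] at h'
  have hcd : (c + d * x : R) = 0 := by
    have : (c + d * x : R) * (σ y - y) = 0 := by linear_combination h' - h
    exact (mul_eq_zero.1 this).resolve_right (sub_ne_zero.2 hy)
  by_cases hcd0 : c = 0 ∧ d = 0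
  · refine rat (a := a) (b := b) (by linear_combination h - y * hcd) ?_
    tauto
  · exact rat hcd hcd0

/-- Multiplying the relation by the conjugate of b + cω turns it into (b² - bc + c²)α ∈ ℤ, and the
norm form vanishes only at 0. -/
theorem indep_of_ne_intCast (hr : Module.finrank ℤ R = 3)
    (hσ' : ∀ x, σ (σ (σ x)) = x) {α : R} {t : ℤ} (ht : α + σ α + σ (σ α) = t)
    (hα : ∀ n : ℤ, α ≠ n) (a b c : ℤ) (h : (a + b * α + c * σ α : R) = 0) :
    a = 0 ∧ b = 0 ∧ c = 0 := by
  have : Module.Finite ℤ R := Module.finite_of_finrank_pos (by omega)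
  have h' := congrArg (fun x => σ (σ x)) h
  simp only [map_add, map_mul, map_intCast, map_zero, hσ'] at h'
  have hN : b ^ 2 - b * c + c ^ 2 = 0 := by
    by_contra hN
    obtain ⟨k, hk⟩ := exists_eq_intCast_of_mul_eq (R := R) (x := α)
      (m := -(a * b + a * c + b * c * t)) hN (by
        push_cast
        linear_combination b * h + c * h' - (b * c : R) * ht)
    exact hα k hk
  have hb : b = 0 := by
    have : b ^ 2 = 0 := by nlinarith [sq_nonneg (b - 2 * c), sq_nonneg b]
    simpa using this
  have hc : c = 0 := by simpa [hb] using hN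
  subst hb hc
  exact ⟨intCast_injective_of_free (R := R) (by simpa using h), rfl, rfl⟩

/-- This is the Euclidean algorithm in ℤ[ω]: the form H is invariant under translation by ℤ and is
multiplied by b² - bc + c² under the action of b + cω, so a nonintegral α with |H α| minimal
generates R/ℤ. -/
theorem exists_isShanksBasis (hr : Module.finrank ℤ R = 3) (hσ : σ ≠ 1)
    (hσ' : ∀ x, σ (σ (σ x)) = x) : ∃ (α : R) (q t : ℤ), IsShanksBasis σ α q t := by
  have : Module.Finite ℤ R := Module.finite_of_finrank_pos (by omega)
  have fixed {x : R} (hx : σ x = x) : ∃ k : ℤ, x = k := exists_eq_intCast_of_fixed hr hσ hx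
  have trace (x : R) : ∃ t : ℤ, x + σ x + σ (σ x) = t :=
    fixed (by simp only [map_add, hσ']; ring)
  have form (x : R) : ∃ n : ℤ, x ^ 2 + σ x ^ 2 + σ (σ x) ^ 2 - x * σ x - σ x * σ (σ x) -
      σ (σ x) * x = n := fixed (by simp only [map_add, map_sub, map_mul, map_pow, hσ']; ring)
  choose H hH using form
  have cast_inj := intCast_injective_of_free (R := R)
  obtain ⟨α, hα, hmin⟩ := (measure fun x => (H x).natAbs).wf.has_min {x : R | ∀ n : ℤ, x ≠ n} (by
    obtain ⟨y, hy⟩ : ∃ y, σ y ≠ y := by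
      by_contra! h
      exact hσ (RingEquiv.ext h)
    exact ⟨y, fun n hn => hy (by rw [hn, map_intCast])⟩)
  obtain ⟨t, ht⟩ := trace α
  have indep := indep_of_ne_intCast hr hσ' ht hα
  have hH0 : H α ≠ 0 := fun h0 => by
    have e := hH α
    rw [h0, Int.cast_zero] at e
    -- If H α = 0, then v behaves as a primitive cube root of unity times u. So u³ and vu² are fixed
    -- by σ, hence integers n and m, and mu = nv is a linear relation between 1, α and σα.
    have e₁ : (α - σ α) ^ 2 + (α - σ α) * (σ α - σ (σ α)) + (σ α - σ (σ α)) ^ 2 = 0 := by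
      linear_combination e
    set u := α - σ α with hu
    set v := σ α - σ (σ α) with hv
    have huv : σ u = v := by rw [hu, hv, map_sub]
    have hvw : σ v = -u - v := by rw [hu, hv, map_sub, hσ']; ring
    obtain ⟨n, hn⟩ := fixed (x := u ^ 3) (by
      rw [map_pow, huv]; linear_combination (v - u) * e₁)
    obtain ⟨m, hm⟩ := fixed (x := v * u ^ 2) (by
      rw [map_mul, map_pow, huv, hvw]; linear_combination -v * e₁)
    have := indep (n * t) (m - n) (-(m + 2 * n)) (by
      push_cast
      rw [← hm, ← hn, ← ht]
      have : (v * u ^ 2) * u - u ^ 3 * v = 0 := by ring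
      linear_combination this - (v * u ^ 2) * hu + u ^ 3 * hv)
    have hn0 : n = 0 := by omega
    rw [hn0, Int.cast_zero] at hn
    have hu0 : u = 0 := by simpa using hn
    obtain ⟨k, hk⟩ := fixed (x := α) (by linear_combination hu - hu0)
    exact hα k hk
  have span (w : R) : ∃ a b c : ℤ, w = a + b * α + c * σ α := by
    obtain ⟨a, b, c, k, hrel, h0⟩ := exists_relation_of_finrank_eq_three hr 1 α (σ α) w
    have hk : k ≠ 0 := by
      rintro rfl
      have := indep a b c (by simpa using hrel)
      tauto
    obtain ⟨b₁, b₂, hb, hb'⟩ := Int.exists_two_mul_abs_le (-b) hk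
    obtain ⟨c₁, c₂, hc, hc'⟩ := Int.exists_two_mul_abs_le (-c) hk
    set w' := w - b₁ * α - c₁ * σ α with hw'
    have hkw : k * w' = -a + b₂ * α + c₂ * σ α := by
      have hbR := congrArg (Int.cast : ℤ → R) hb
      have hcR := congrArg (Int.cast : ℤ → R) hc
      push_cast at hbR hcR
      rw [hw']
      linear_combination hrel + α * hbR + σ α * hcR
    by_cases hw : ∀ n : ℤ, w' ≠ n
    · exfalso
      refine hmin w' hw ?_
      have hkσ := congrArg σ hkw
      have hkσσ := congrArg σ hkσ
      simp only [map_add, map_mul, map_intCast, map_neg, hσ'] at hkσ hkσσ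
      -- Rounding b and c to nearest multiples of k makes the norm of b₂ + c₂ω at most 3k²/4, so |H
      -- w'| < |H α| unless w' is an integer.
      have key : k ^ 2 * H w' = (b₂ ^ 2 - b₂ * c₂ + c₂ ^ 2) * H α := by
        apply cast_inj
        push_cast
        rw [← hH, ← hH]
        calc _ = (k * w') ^ 2 + (k * σ w') ^ 2 + (k * σ (σ w')) ^ 2 - (k * w') * (k * σ w') -
            (k * σ w') * (k * σ (σ w')) - (k * σ (σ w')) * (k * w') := by ring
          _ = _ := by rw [hkw, hkσ, hkσσ]; ring
      have hb2 : 4 * b₂ ^ 2 ≤ k ^ 2 := by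
        rw [← sq_abs b₂, ← sq_abs k]; nlinarith [abs_nonneg b₂]
      have hc2 : 4 * c₂ ^ 2 ≤ k ^ 2 := by
        rw [← sq_abs c₂, ← sq_abs k]; nlinarith [abs_nonneg c₂]
      have hN : 4 * (b₂ ^ 2 - b₂ * c₂ + c₂ ^ 2) ≤ 3 * k ^ 2 := by
        nlinarith [sq_nonneg (b₂ + c₂)]
      have hN0 : 0 ≤ b₂ ^ 2 - b₂ * c₂ + c₂ ^ 2 := by
        nlinarith [sq_nonneg (b₂ - c₂), sq_nonneg b₂, sq_nonneg c₂]
      have habs : k ^ 2 * |H w'| = (b₂ ^ 2 - b₂ * c₂ + c₂ ^ 2) * |H α| := by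
        have := congrArg abs key
        rwa [abs_mul, abs_mul, abs_of_nonneg hN0, abs_of_nonneg (sq_nonneg k)] at this
      have hk2 : 0 < k ^ 2 := by positivity
      have hHpos : 0 < |H α| := abs_pos.2 hH0
      have hlt : |H w'| < |H α| := by
        by_contra! hle
        nlinarith [mul_le_mul_of_nonneg_left hle hk2.le, mul_le_mul_of_nonneg_right hN hHpos.le,
          mul_pos hk2 hHpos]
      change (H w').natAbs < (H α).natAbs
      zify
      exact hlt
    · push Not at hw
      obtain ⟨n, hn⟩ := hw
      exact ⟨n, b₁, c₁, by linear_combination hn + hw'⟩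
  obtain ⟨p, x, y, hp⟩ := span (α * σ α)
  -- Shifting α by y removes the σα-term of the product.
  have hα' : (α - y) * σ (α - y) = (x - y) * (α - y) + (p + x * y) := by
    rw [map_sub, map_intCast]; linear_combination hp
  have hσα' := congrArg σ hα'
  have hσσα' := congrArg σ hσα'
  simp only [map_add, map_mul, map_intCast, map_sub, hσ'] at hα' hσα' hσσα'
  have hpq : p + x * y = -(x - y) ^ 2 := by
    -- The product of the three conjugates of α - y, computed in two ways.
    have hz : ((p + x * y + (x - y) ^ 2 : ℤ) : R) * (σ (σ α) - α) = 0 := by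
      push_cast
      linear_combination (α - y) * hσα' - (σ (σ α) - y) * hα' + (x - y : R) * hα' -
        (x - y : R) * hσσα'
    have hne : σ (σ α) - α ≠ 0 := fun h => by
      obtain ⟨k, hk⟩ := fixed (x := α) (by
        have := congrArg σ h
        rw [map_sub, hσ', map_zero] at this
        linear_combination -this)
      exact hα k hk
    have := (mul_eq_zero.1 hz).resolve_right hne
    have : p + x * y + (x - y) ^ 2 = 0 := cast_inj (by simpa using this)
    linarith
  refine ⟨α - y, x - y, t - 3 * y, fun w => ?_, fun a b c h => ?_, ?_, ?_⟩
  · obtain ⟨a, b, c, rfl⟩ := span w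
    refine ⟨a + b * y + c * y, b, c, ?_⟩
    rw [map_sub, map_intCast]; push_cast; ring
  · have := indep (a - b * y - c * y) b c (by
      rw [← h, map_sub, map_intCast]; push_cast; ring)
    obtain ⟨h₁, rfl, rfl⟩ := this
    simpa using h₁
  · have := congrArg (Int.cast : ℤ → R) hpq
    push_cast at this ⊢
    rw [map_sub, map_intCast]
    linear_combination hα' + this
  · simp only [map_sub, map_intCast]; push_cast; linear_combination ht

end FreeDomain

/-! ### Shanks rings that are domains -/

namespace ShanksRing

-- A monic integral cubic without integer roots is irreducible over ℚ, and the Shanks ring embeds in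
-- the cubic field that it defines.
open Polynomial in
theorem isDomain {q t : ℤ} (hq : q ≠ 0)
    (h : ∀ r : ℤ, r ^ 3 - t * r ^ 2 + (q * t - 3 * q ^ 2) * r + q ^ 3 ≠ 0) :
    IsDomain (ShanksRing q t) := by
  let f : ℤ[X] := X ^ 3 - C t * X ^ 2 + C (q * t - 3 * q ^ 2) * X + C (q ^ 3)
  have hfd : f.natDegree = 3 := by unfold f; compute_degree!
  have hfm : f.Monic := by unfold f; monicity!
  let g : ℚ[X] := f.map (algebraMap ℤ ℚ)
  have hgm : g.Monic := hfm.map _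
  have hgd : g.natDegree = 3 := by rw [hfm.natDegree_map, hfd]
  have hg : Irreducible g := by
    rw [hgm.irreducible_iff_roots_eq_zero_of_degree_le_three (by omega) (by omega),
      Multiset.eq_zero_iff_forall_notMem]
    intro x hx
    rw [mem_roots hgm.ne_zero, IsRoot.def, eval_map_algebraMap] at hx
    obtain ⟨r, rfl⟩ := isInteger_of_is_root_of_monic hfm hx
    rw [aeval_algebraMap_apply, map_eq_zero_iff _ (algebraMap ℤ ℚ).injective_int] at hx
    refine h r ?_
    simpa [f] using hx
  have : Fact (Irreducible g) := ⟨hg⟩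
  let K := AdjoinRoot g
  let α : K := AdjoinRoot.root g
  have hα : α ^ 3 - t * α ^ 2 + (q * t - 3 * q ^ 2) * α + q ^ 3 = 0 := by
    have hg' : g = X ^ 3 - (t : ℚ[X]) * X ^ 2 +
        ((q : ℚ[X]) * (t : ℚ[X]) - 3 * (q : ℚ[X]) ^ 2) * X + (q : ℚ[X]) ^ 3 := by
      simp [g, f]
    have : AdjoinRoot.mk g (X ^ 3 - (t : ℚ[X]) * X ^ 2 +
        ((q : ℚ[X]) * (t : ℚ[X]) - 3 * (q : ℚ[X]) ^ 2) * X + (q : ℚ[X]) ^ 3) = 0 := by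
      rw [← hg']
      exact AdjoinRoot.mk_self
    simpa [map_ofNat (AdjoinRoot.mk g) 3] using this
  have hqK : (q : K) ≠ 0 := by
    have : CharZero K := charZero_of_injective_algebraMap (algebraMap ℚ K).injective
    exact_mod_cast hq
  let β : K := (α ^ 2 - t * α - (2 * q ^ 2 - q * t)) / q
  have hβ : q * β = α ^ 2 - t * α - (2 * q ^ 2 - q * t) := mul_div_cancel₀ _ hqK
  have hαβ : α * β = q * α - q ^ 2 := by
    apply mul_left_cancel₀ hqK
    linear_combination α * hβ + hα
  have hββ : β ^ 2 = 2 * q ^ 2 - q * α + (t - q) * β := by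
    apply mul_left_cancel₀ hqK
    linear_combination β * hβ + α * hαβ - t * hαβ - q * hβ 
  let φ : ShanksRing q t →+* K := lift α β (by linear_combination -hβ) hαβ hββ
  have hφ : Function.Injective φ := by
    rw [injective_iff_map_eq_zero]
    intro x hx
    change (x.1 + x.2 * α + x.3 * β : K) = 0 at hx
    -- This quadratic represents q times the image of x, after elimination of β.
    let p : ℚ[X] := C (x.3 : ℚ) * X ^ 2 + C (q * x.2 - x.3 * t : ℚ) * X +
      C (q * x.1 - x.3 * (2 * q ^ 2 - q * t) : ℚ)
    have hp : AdjoinRoot.mk g p = 0 := by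
      simp only [p, map_add, map_mul, map_sub, map_pow, map_intCast, map_ofNat, AdjoinRoot.mk_X]
      linear_combination (q : K) * hx - (x.3 : K) * hβ
    have hp0 : p = 0 := eq_zero_of_dvd_of_natDegree_lt (AdjoinRoot.mk_eq_zero.1 hp) (by
      rw [hgd]
      exact lt_of_le_of_lt natDegree_quadratic_le (by norm_num))
    have h2 := congrArg (coeff · 2) hp0
    have h1 := congrArg (coeff · 1) hp0
    have h0 := congrArg (coeff · 0) hp0
    simp only [p, coeff_add, coeff_C_mul, coeff_X_pow, coeff_X, coeff_C] at h0 h1 h2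
    norm_num at h2
    norm_num [h2, hq] at h1
    norm_num [h2, hq] at h0
    exact ShanksRing.ext h0 h1 h2
  exact hφ.isDomain φ

end ShanksRing

/-! ### Isomorphism classes as normalized parameters -/

namespace CubicOrder

/-- The Shanks rings that are cubic orders. -/
abbrev ofShanks (p : {p : ℤ × ℤ // IsDomain (ShanksRing p.1 p.2)}) : CubicOrder :=
  letI := p.2
  { carrier := ShanksRing p.1.1 p.1.2
    finrank_eq := ShanksRing.finrank_eq }

theorem disc_of_isShanksBasis (R : CubicOrder) {σ : R.carrier ≃+* R.carrier} {α : R.carrier}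
    {q t : ℤ} (h : IsShanksBasis σ α q t) : R.disc = (t ^ 2 - 3 * q * t + 9 * q ^ 2) ^ 2 := by
  let e : ShanksRing q t ≃ₐ[ℤ] R.carrier := AlgEquiv.ofRingEquiv (f := h.equiv) fun n => by simp
  rw [R.disc_eq ((ShanksRing.basis q t).map e.toLinearEquiv), ← ShanksRing.discr_basis,
    Algebra.discr_eq_discr_of_algEquiv _ e]
  congr 1

theorem exists_isShanksBasis (R : CubicOrder) (h : R.HasAutC3) :
    ∃ (σ : R.carrier ≃+* R.carrier) (α : R.carrier) (q t : ℤ), IsShanksBasis σ α q t ∧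
      0 < q ∧ 3 * q ≤ 2 * t := by
  obtain ⟨e⟩ := h
  let σ : RingAut R.carrier := e.symm (Multiplicative.ofAdd 1)
  have h1 : σ ≠ 1 := by
    rw [ne_eq, MulEquivClass.map_eq_one_iff]
    decide
  have h3 : σ ^ 3 = 1 := by
    rw [← map_pow, MulEquivClass.map_eq_one_iff]
    decide
  obtain ⟨α, q, t, hα⟩ := _root_.exists_isShanksBasis (σ := σ) R.finrank_eq h1 fun x =>
    DFunLike.congr_fun h3 x
  exact hα.exists_normalized

/-- Parameters of the Shanks rings of discriminant less than `X`, one for each orbit of the group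
of order 4 that acts on them. -/
def shanksParams (X : ℝ) : Set (ℤ × ℤ) :=
  {p | 0 < p.1 ∧ 3 * p.1 ≤ 2 * p.2 ∧
    (((p.2 ^ 2 - 3 * p.1 * p.2 + 9 * p.1 ^ 2) ^ 2 : ℤ) : ℝ) < X}

theorem c3Classes_eq_image (X : ℝ) :
    c3Classes X = (fun p => Quotient.mk isoSetoid (ofShanks p)) '' {p | p.1 ∈ shanksParams X} := by
  ext c
  constructor
  · rintro ⟨R, ⟨hR, hX⟩, rfl⟩
    obtain ⟨σ, α, q, t, h, hq, ht⟩ := R.exists_isShanksBasis hR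
    refine ⟨⟨(q, t), h.equiv.toMulEquiv.isDomain _⟩, ⟨hq, ht, ?_⟩, Quotient.sound ⟨h.equiv⟩⟩
    rwa [← R.disc_of_isShanksBasis h]
  · rintro ⟨⟨⟨q, t⟩, hp⟩, ⟨hq, ht, hX⟩, rfl⟩
    have h := ShanksRing.isShanksBasis q t
    refine ⟨ofShanks ⟨(q, t), hp⟩, ⟨h.nonempty_ringAut_equiv, ?_⟩, rfl⟩
    rwa [(ofShanks ⟨(q, t), hp⟩).disc_of_isShanksBasis h]

theorem injOn_mk_ofShanks (X : ℝ) :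
    Set.InjOn (fun p => Quotient.mk isoSetoid (ofShanks p)) {p | p.1 ∈ shanksParams X} := by
  rintro ⟨⟨q, t⟩, hp⟩ ⟨hq, ht, -⟩ ⟨⟨q', t'⟩, hp'⟩ ⟨hq', ht', -⟩ he
  obtain ⟨e⟩ := Quotient.exact he
  have := (ShanksRing.isShanksBasis q' t').parameters_eq
    ((ShanksRing.isShanksBasis q t).map (e : ShanksRing q t ≃+* ShanksRing q' t'))
  simp only [Subtype.mk.injEq, Prod.mk.injEq]
  dsimp only at hq hq' ht ht'
  omega

theorem ncard_c3Classes (X : ℝ) : (c3Classes X).ncard =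
    {p ∈ shanksParams X | IsDomain (ShanksRing p.1 p.2)}.ncard := by
  rw [c3Classes_eq_image, (injOn_mk_ofShanks X).ncard_image,
    ← Set.ncard_image_of_injective _ Subtype.val_injective]
  congr 1
  ext p
  simp [and_comm]

end CubicOrder

/-! ### Lattice points in a quarter ellipse -/

theorem abs_card_Ico_ceil_sub_le {a L : ℝ} (hL : 0 ≤ L) :
    |((Finset.Ico ⌈a⌉ ⌈a + L⌉).card : ℝ) - L| ≤ 1 := by
  have h : ⌈a⌉ ≤ ⌈a + L⌉ := Int.ceil_mono (by linarith)
  have hc : ((Finset.Ico ⌈a⌉ ⌈a + L⌉).card : ℝ) = ⌈a + L⌉ - ⌈a⌉ := by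
    rw [Int.card_Ico]
    have : (((⌈a + L⌉ - ⌈a⌉).toNat : ℤ) : ℝ) = ((⌈a + L⌉ - ⌈a⌉ : ℤ) : ℝ) := by
      rw [Int.toNat_of_nonneg (by omega)]
    exact_mod_cast this
  rw [hc, abs_le]
  constructor <;>
    linarith [Int.le_ceil a, Int.ceil_lt_add_one a, Int.le_ceil (a + L),
      Int.ceil_lt_add_one (a + L)]

theorem integral_sqrt_one_sub_sq_of_one_le {A : ℝ} (hA : 1 ≤ A) :
    ∫ x in (0 : ℝ)..A, √(1 - x ^ 2) = Real.pi / 4 := by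
  have hi (a b : ℝ) : IntervalIntegrable (fun x : ℝ => √(1 - x ^ 2)) MeasureTheory.volume a b :=
    (by fun_prop : Continuous fun x : ℝ => √(1 - x ^ 2)).intervalIntegrable a b
  -- Beyond 1 the radicand is negative and `√` takes its default value 0.
  have h1 : ∫ x in (1 : ℝ)..A, √(1 - x ^ 2) = 0 := by
    rw [intervalIntegral.integral_congr (g := fun _ => 0)]
    · simp
    · intro x hx
      rw [Set.uIcc_of_le hA] at hx
      exact Real.sqrt_eq_zero_of_nonpos (by nlinarith [hx.1])
  have h2 : ∫ x in (-1 : ℝ)..0, √(1 - x ^ 2) = ∫ x in (0 : ℝ)..1, √(1 - x ^ 2) := by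
    have := intervalIntegral.integral_comp_neg (a := -1) (b := 0) fun x : ℝ => √(1 - x ^ 2)
    simpa using this
  have h3 := integral_sqrt_one_sub_sq
  rw [← intervalIntegral.integral_add_adjacent_intervals (hi (-1) 0) (hi 0 1), h2] at h3
  rw [← intervalIntegral.integral_add_adjacent_intervals (hi 0 1) (hi 1 A), h1]
  linarith

theorem integral_sqrt_sub_mul_sq {T A : ℝ} (hT : 0 < T) (hA : T ≤ A) :
    ∫ x in (0 : ℝ)..A, √(T ^ 2 - 27 / 4 * x ^ 2) = Real.pi / (6 * √3) * T ^ 2 := by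
  have h3 : √3 ^ 2 = (3 : ℝ) := Real.sq_sqrt (by norm_num)
  have h3' : 0 < √(3 : ℝ) := by positivity
  set c := 2 * T / (3 * √3) with hc
  have hc0 : 0 < c := by positivity
  have hcT : c ≤ T := by
    rw [hc, div_le_iff₀ (by positivity)]
    nlinarith [Real.one_le_sqrt.2 (by norm_num : (1 : ℝ) ≤ 3)]
  have hcc : c ^ 2 = 4 * T ^ 2 / 27 := by
    rw [hc, div_pow, mul_pow, mul_pow, h3]; ring
  have h (x : ℝ) : √(T ^ 2 - 27 / 4 * x ^ 2) = T * √(1 - (x / c) ^ 2) := by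
    rw [← Real.sqrt_sq hT.le, ← Real.sqrt_mul (sq_nonneg T), Real.sqrt_sq hT.le, div_pow, hcc]
    congr 1
    field_simp
  simp only [h]
  rw [intervalIntegral.integral_const_mul,
    intervalIntegral.integral_comp_div (fun x => √(1 - x ^ 2)) hc0.ne', zero_div,
    integral_sqrt_one_sub_sq_of_one_le ((one_le_div hc0).2 (hcT.trans hA)), hc, smul_eq_mul]
  field_simp
  ring

/-- The summand decreases, so sum and integral differ by at most its value T at 0. Rows beyond the
ellipse contribute 0. -/
theorem abs_sum_sqrt_sub_le {T : ℝ} {M : ℕ} (hT : 0 < T) (hM : T ≤ M) :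
    |∑ i ∈ Finset.range M, √(T ^ 2 - 27 / 4 * ((i + 1 : ℕ) : ℝ) ^ 2) -
      Real.pi / (6 * √3) * T ^ 2| ≤ T := by
  have hanti : AntitoneOn (fun x : ℝ => √(T ^ 2 - 27 / 4 * x ^ 2)) (Set.Icc 0 (0 + M)) := by
    intro x hx y hy hxy
    apply Real.sqrt_le_sqrt
    nlinarith [hx.1]
  have h1 := hanti.sum_le_integral
  have h2 := hanti.integral_le_sum
  simp only [zero_add] at h1 h2
  rw [integral_sqrt_sub_mul_sq hT hM] at h1 h2
  have h3 := Finset.sum_range_succ' (fun i : ℕ => √(T ^ 2 - 27 / 4 * (i : ℝ) ^ 2)) M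
  rw [Finset.sum_range_succ] at h3
  simp only [Nat.cast_zero, ne_eq, OfNat.ofNat_ne_zero, not_false_eq_true, zero_pow, mul_zero,
    sub_zero, Real.sqrt_sq hT.le] at h3
  have h4 := Real.sqrt_nonneg (T ^ 2 - 27 / 4 * (M : ℝ) ^ 2)
  rw [abs_le]
  constructor <;> linarith

namespace CubicOrder

theorem mem_shanksParams_pow_four {T : ℝ} {p : ℤ × ℤ} :
    p ∈ shanksParams (T ^ 4) ↔ 0 < p.1 ∧ 3 * p.1 ≤ 2 * p.2 ∧
      ((p.2 ^ 2 - 3 * p.1 * p.2 + 9 * p.1 ^ 2 : ℤ) : ℝ) < T ^ 2 := by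
  have h0 : (0 : ℝ) ≤ (p.2 ^ 2 - 3 * p.1 * p.2 + 9 * p.1 ^ 2 : ℤ) := by
    have : 0 ≤ p.2 ^ 2 - 3 * p.1 * p.2 + 9 * p.1 ^ 2 := by
      nlinarith [sq_nonneg (2 * p.2 - 3 * p.1), sq_nonneg p.1]
    exact_mod_cast this
  rw [shanksParams, Set.mem_ofPred_eq, Int.cast_pow, show T ^ 4 = (T ^ 2) ^ 2 by ring,
    sq_lt_sq₀ h0 (sq_nonneg T)]

/-- The elements of `shanksParams (T ^ 4)`, as pairs of the predecessor of the first parameter and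
the second parameter. -/
noncomputable def shanksParamsFinset (T : ℝ) (M : ℕ) : Finset (Σ _ : ℕ, ℤ) :=
  (Finset.range M).sigma fun i => Finset.Ico ⌈(3 / 2 * ((i + 1 : ℕ) : ℝ))⌉
    ⌈3 / 2 * ((i + 1 : ℕ) : ℝ) + √(T ^ 2 - 27 / 4 * ((i + 1 : ℕ) : ℝ) ^ 2)⌉

theorem shanksParams_eq_image {T : ℝ} {M : ℕ} (hT : 0 < T) (hM : T ≤ M) :
    shanksParams (T ^ 4) =
      (fun p : Σ _ : ℕ, ℤ => ((p.1 + 1 : ℤ), p.2)) '' (shanksParamsFinset T M : Set _) := by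
  -- Completing the square: t² - 3qt + 9q² = (t - 3q/2)² + 27q²/4.
  have key (q t : ℝ) (h : 3 / 2 * q ≤ t) : t < 3 / 2 * q + √(T ^ 2 - 27 / 4 * q ^ 2) ↔
      t ^ 2 - 3 * q * t + 9 * q ^ 2 < T ^ 2 := by
    rw [← sub_lt_iff_lt_add', Real.lt_sqrt (by linarith)]
    constructor <;> intro h <;> linarith
  ext ⟨q, t⟩
  rw [mem_shanksParams_pow_four]
  simp only [shanksParamsFinset, Finset.coe_sigma, Finset.coe_range, Finset.coe_Ico, Set.mem_image,
    Set.mem_sigma_iff, Set.mem_Iio, Set.mem_Ico, Int.ceil_le, Int.lt_ceil, Prod.mk.injEq,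
    Sigma.exists]
  constructor
  · rintro ⟨hq, ht, hQ⟩
    obtain ⟨i, rfl⟩ : ∃ i : ℕ, q = i + 1 := ⟨(q - 1).toNat, by omega⟩
    have ht' : (3 / 2 * ((i + 1 : ℕ) : ℝ)) ≤ t := by
      have : (3 * (i + 1) : ℝ) ≤ 2 * t := by exact_mod_cast ht
      push_cast; linarith
    push_cast at hQ
    refine ⟨i, t, ⟨?_, ht', ?_⟩, rfl, rfl⟩
    · have : ((i : ℝ) + 1) < T := by
        apply lt_of_pow_lt_pow_left₀ 2 hT.le
        nlinarith [sq_nonneg (t - 3 / 2 * (i + 1) : ℝ), sq_nonneg (i + 1 : ℝ)]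
      have : (i : ℝ) < M := by linarith
      exact_mod_cast this
    · rw [key _ _ ht']
      push_cast; exact hQ
  · rintro ⟨i, t, ⟨-, ht, hQ⟩, rfl, rfl⟩
    rw [key _ _ ht] at hQ
    push_cast at ht hQ ⊢
    refine ⟨by omega, ?_, hQ⟩
    have : (3 * (i + 1) : ℝ) ≤ 2 * t := by linarith
    exact_mod_cast this

theorem ncard_shanksParams {T : ℝ} {M : ℕ} (hT : 0 < T) (hM : T ≤ M) :
    (shanksParams (T ^ 4)).ncard = (shanksParamsFinset T M).card := by
  rw [shanksParams_eq_image hT hM, Set.ncard_image_of_injective, Set.ncard_coe_finset]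
  rintro ⟨i, s⟩ ⟨j, t⟩ h
  simpa using h

theorem finite_shanksParams (X : ℝ) : (shanksParams X).Finite := by
  -- The summand 1 keeps the fourth root positive, also for X = 0.
  have hX : X ≤ (√√|X| + 1) ^ 4 := by
    have : X ≤ √√|X| ^ 4 := by
      rw [show √√|X| ^ 4 = (√√|X| ^ 2) ^ 2 by ring, Real.sq_sqrt (Real.sqrt_nonneg _),
        Real.sq_sqrt (abs_nonneg _)]
      exact le_abs_self X
    exact this.trans (by gcongr; linarith)
  refine Set.Finite.subset (s := shanksParams ((√√|X| + 1) ^ 4)) ?_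
    fun p hp => ⟨hp.1, hp.2.1, hp.2.2.trans_le hX⟩
  obtain ⟨M, hM⟩ := exists_nat_ge (√√|X| + 1)
  rw [shanksParams_eq_image (by positivity) hM]
  exact (Finset.finite_toSet _).image _

/-- The error is at most T from comparing sum and integral, plus 1 for each of the ⌈T⌉ < T + 1 ≤ 2T
rows. -/
theorem abs_ncard_shanksParams_sub_le {T : ℝ} (hT : 1 ≤ T) :
    |((shanksParams (T ^ 4)).ncard : ℝ) - Real.pi / (6 * √3) * T ^ 2| ≤ 3 * T := by
  have hT0 : 0 < T := by linarith
  have hM := Nat.le_ceil T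
  have hM' := Nat.ceil_lt_add_one hT0.le
  have h1 := abs_sum_sqrt_sub_le hT0 hM
  have h2 : |((shanksParamsFinset T ⌈T⌉₊).card : ℝ) -
      ∑ i ∈ Finset.range ⌈T⌉₊, √(T ^ 2 - 27 / 4 * ((i + 1 : ℕ) : ℝ) ^ 2)| ≤ ⌈T⌉₊ := by
    rw [shanksParamsFinset, Finset.card_sigma, Nat.cast_sum, ← Finset.sum_sub_distrib]
    refine (Finset.abs_sum_le_sum_abs _ _).trans ?_
    refine (Finset.sum_le_card_nsmul _ _ 1 fun i _ =>
      abs_card_Ico_ceil_sub_le (Real.sqrt_nonneg _)).trans ?_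
    simp
  rw [ncard_shanksParams hT0 hM]
  rw [abs_le] at h1 h2 ⊢
  constructor <;> linarith [h1.1, h1.2, h2.1, h2.2]

end CubicOrder

/-! ### Parameters with a reducible cubic -/

/-- If the cubic polynomial attached to a Shanks ring has a root, then it is a multiple of a
product of three linear factors that are permuted by an automorphism of order 3. -/
theorem exists_of_shanks_root {q t r : ℤ} (hq : 0 < q)
    (h : r ^ 3 - t * r ^ 2 + (q * t - 3 * q ^ 2) * r + q ^ 3 = 0) :
    ∃ m a b : ℤ, q = m * a * b * (a - b) ∧ t = m * (a ^ 3 - 3 * a * b ^ 2 + b ^ 3) := by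
  obtain ⟨a, b, hab, hr, hb⟩ := Int.exists_gcd_one (m := r) (n := q)
    (Int.gcd_pos_of_ne_zero_right _ hq.ne')
  set g : ℤ := (r.gcd q : ℤ) with hg
  have hg0 : g ≠ 0 := by
    intro h0
    rw [h0] at hb
    omega
  have hco : IsCoprime a b := Int.isCoprime_iff_gcd_eq_one.2 hab
  -- The root equation is linear in t. Both a and a - b are coprime to the cubic form on the right,
  -- so their product divides g.
  have ht : t * (a * (a - b)) = g * (a ^ 3 - 3 * a * b ^ 2 + b ^ 3) := by
    apply mul_left_cancel₀ (pow_ne_zero 2 hg0)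
    rw [hr, hb] at h
    linear_combination -h
  have h1 : IsCoprime a (a ^ 3 - 3 * a * b ^ 2 + b ^ 3) := by
    rw [show a ^ 3 - 3 * a * b ^ 2 + b ^ 3 = b ^ 3 + a * (a ^ 2 - 3 * b ^ 2) by ring]
    exact IsCoprime.add_mul_left_right hco.pow_right _
  have h2 : IsCoprime (a - b) (a ^ 3 - 3 * a * b ^ 2 + b ^ 3) := by
    have hco' : IsCoprime (a - b) b := by
      rw [show a - b = a + b * (-1) by ring]
      exact IsCoprime.add_mul_left_left hco _
    rw [show a ^ 3 - 3 * a * b ^ 2 + b ^ 3 =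
      -b ^ 3 + (a - b) * (a ^ 2 + a * b - 2 * b ^ 2) by ring]
    exact IsCoprime.add_mul_left_right hco'.pow_right.neg_right _
  obtain ⟨m, hm⟩ : a * (a - b) ∣ g :=
    (h1.mul_left h2).dvd_of_dvd_mul_right (Dvd.intro_left t ht)
  refine ⟨m, a, b, by rw [hb, hm]; ring, ?_⟩
  have h0 : a * (a - b) ≠ 0 := by
    rintro h0
    rw [h0, zero_mul] at hm
    exact hg0 hm
  apply mul_right_cancel₀ h0
  rw [ht, hm]
  ring

theorem Set.ncard_sep_add_ncard_sep_not {α : Type*} {s : Set α} (hs : s.Finite) (P : α → Prop) :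
    {x ∈ s | P x}.ncard + {x ∈ s | ¬P x}.ncard = s.ncard := by
  rw [← Set.ncard_union_eq (t := {x ∈ s | ¬P x})
    (Set.disjoint_left.2 fun x hx hx' => hx'.2 hx.2)
    (hs.subset (Set.sep_subset _ _)) (hs.subset (Set.sep_subset _ _))]
  congr 1
  ext x
  by_cases h : P x <;> simp [h]

theorem Int.exists_sign_mul_succ {m : ℤ} (hm : m ≠ 0) :
    ∃ e ∈ ({1, -1} : Finset ℤ), ∃ l : ℕ, m = e * (l + 1) := by
  rcases lt_or_gt_of_ne hm with h | h
  · exact ⟨-1, by simp, (-m - 1).toNat, by omega⟩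
  · exact ⟨1, by simp, (m - 1).toNat, by omega⟩

namespace CubicOrder

/-- The parameters of a Shanks ring whose cubic polynomial is reducible. -/
def reducibleParams (m a b : ℤ) : ℤ × ℤ :=
  (m * a * b * (a - b), m * (a ^ 3 - 3 * a * b ^ 2 + b ^ 3))

/-- Triples `(a - 1, b - 1, m - 1)` of natural numbers with `m (a b) ^ (3 / 2) ≤ T` and
`a, b ≤ M`. -/
noncomputable def reducibleTriples (T : ℝ) (M : ℕ) : Finset (Σ _ : ℕ × ℕ, ℕ) :=
  (Finset.range M ×ˢ Finset.range M).sigma fun p =>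
    Finset.range ⌊T * (1 / (p.1 + 1 : ℝ) ^ (3 / 2 : ℝ) * (1 / (p.2 + 1 : ℝ) ^ (3 / 2 : ℝ)))⌋₊

/-- The double sum factors, and each factor converges because 3/2 > 1; this keeps the bound linear
in T. -/
theorem card_reducibleTriples_le {T : ℝ} (hT : 0 ≤ T) (M : ℕ) :
    ((reducibleTriples T M).card : ℝ) ≤ T * (∑' n : ℕ, 1 / (n + 1 : ℝ) ^ (3 / 2 : ℝ)) ^ 2 := by
  have hs : Summable fun n : ℕ => 1 / (n + 1 : ℝ) ^ (3 / 2 : ℝ) := by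
    have := (summable_nat_add_iff 1).2 (Real.summable_one_div_nat_rpow.2
      (by norm_num : (1 : ℝ) < 3 / 2))
    simpa using this
  have h0 (n : ℕ) : 0 ≤ 1 / (n + 1 : ℝ) ^ (3 / 2 : ℝ) := by positivity
  rw [reducibleTriples, Finset.card_sigma, Nat.cast_sum]
  calc _ ≤ ∑ p ∈ Finset.range M ×ˢ Finset.range M,
        T * (1 / (p.1 + 1 : ℝ) ^ (3 / 2 : ℝ) * (1 / (p.2 + 1 : ℝ) ^ (3 / 2 : ℝ))) := by
        refine Finset.sum_le_sum fun p _ => ?_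
        rw [Finset.card_range]
        exact Nat.floor_le (mul_nonneg hT (mul_nonneg (h0 _) (h0 _)))
    _ = T * (∑ n ∈ Finset.range M, 1 / (n + 1 : ℝ) ^ (3 / 2 : ℝ)) ^ 2 := by
        rw [← Finset.mul_sum, sq, Finset.sum_mul_sum, Finset.sum_product]
    _ ≤ _ := by
        gcongr
        · exact hs.sum_le_tsum _ fun n _ => h0 n

/-- The hypothesis bounds (i + 1)(j + 1) by T, so the cutoff M loses nothing; its square root bounds
l + 1. -/
theorem mem_reducibleTriples {T : ℝ} {M i j l : ℕ} (hT : 0 ≤ T) (hM : T ≤ M)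
    (h : ((l + 1 : ℝ) ^ 2 * ((i + 1) * (j + 1)) ^ 3) < T ^ 2) :
    (⟨(i, j), l⟩ : Σ _ : ℕ × ℕ, ℕ) ∈ reducibleTriples T M := by
  have hi : (1 : ℝ) ≤ i + 1 := by simp
  have hj : (1 : ℝ) ≤ j + 1 := by simp
  have hl : (1 : ℝ) ≤ l + 1 := by simp
  have hij : (1 : ℝ) ≤ (i + 1) * (j + 1) := by nlinarith
  have hl2 : (1 : ℝ) ≤ (l + 1) ^ 2 := by nlinarith
  have hlt : (((i : ℝ) + 1) * (j + 1)) ^ 2 < T ^ 2 := by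
    refine lt_of_le_of_lt ?_ h
    have : (((i : ℝ) + 1) * (j + 1)) ^ 2 ≤ ((i + 1) * (j + 1)) ^ 3 :=
      pow_le_pow_right₀ hij (by norm_num)
    nlinarith [pow_nonneg (zero_le_one.trans hij) 3]
  have hlt' := lt_of_pow_lt_pow_left₀ 2 hT hlt
  have hiM : (i : ℝ) < M := by nlinarith
  have hjM : (j : ℝ) < M := by nlinarith
  simp only [reducibleTriples, Finset.mem_sigma, Finset.mem_product, Finset.mem_range]
  refine ⟨⟨by exact_mod_cast hiM, by exact_mod_cast hjM⟩, ?_⟩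
  rw [← Nat.succ_le_iff, Nat.le_floor_iff' (Nat.succ_ne_zero l), div_mul_div_comm, one_mul,
    mul_one_div, ← Real.mul_rpow (by positivity) (by positivity), le_div_iff₀ (by positivity)]
  refine (lt_of_pow_lt_pow_left₀ 2 hT ?_).le
  rw [mul_pow, ← Real.rpow_natCast (_ ^ (3 / 2 : ℝ)), ← Real.rpow_mul (by positivity)]
  norm_num
  exact_mod_cast h

theorem exists_reducibleParams_eq {T : ℝ} {M : ℕ} (hT : 0 ≤ T) (hM : T ≤ M) {p : ℤ × ℤ}
    (hp : p ∈ shanksParams (T ^ 4)) (hd : ¬IsDomain (ShanksRing p.1 p.2)) :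
    ∃ e₁ ∈ ({1, -1} : Finset ℤ), ∃ e₂ ∈ ({1, -1} : Finset ℤ), ∃ e₃ ∈ ({1, -1} : Finset ℤ),
      ∃ x ∈ reducibleTriples T M,
        reducibleParams (e₁ * (x.2 + 1)) (e₂ * (x.1.1 + 1)) (e₃ * (x.1.2 + 1)) = p := by
  obtain ⟨q, t⟩ := p
  obtain ⟨hq, -, hQ⟩ := mem_shanksParams_pow_four.1 hp
  dsimp only at hq hQ hd
  obtain ⟨r, hr⟩ : ∃ r : ℤ, r ^ 3 - t * r ^ 2 + (q * t - 3 * q ^ 2) * r + q ^ 3 = 0 := by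
    by_contra! h
    exact hd (ShanksRing.isDomain hq.ne' h)
  obtain ⟨m, a, b, hqm, htm⟩ := exists_of_shanks_root hq hr
  have hne : m ≠ 0 ∧ a ≠ 0 ∧ b ≠ 0 := by
    refine ⟨?_, ?_, ?_⟩ <;> rintro rfl <;> simp at hqm <;> omega
  obtain ⟨e₁, he₁, l, hl⟩ := Int.exists_sign_mul_succ hne.1
  obtain ⟨e₂, he₂, i, hi⟩ := Int.exists_sign_mul_succ hne.2.1
  obtain ⟨e₃, he₃, j, hj⟩ := Int.exists_sign_mul_succ hne.2.2
  refine ⟨e₁, he₁, e₂, he₂, e₃, he₃, ⟨(i, j), l⟩, mem_reducibleTriples hT hM ?_, ?_⟩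
  · have hsq {e : ℤ} (he : e ∈ ({1, -1} : Finset ℤ)) : e ^ 2 = 1 := by
      rw [Finset.mem_insert, Finset.mem_singleton] at he
      rcases he with rfl | rfl <;> rfl
    -- The norm form dominates |ab|, since (a - b)² ≥ 0 and a² + b² ≥ 0.
    have hle : ((i + 1) * (j + 1) : ℤ) ≤ a ^ 2 - a * b + b ^ 2 := by
      have hij : ((i + 1) * (j + 1) : ℤ) = |a * b| := by
        rw [hi, hj, show e₂ * (i + 1 : ℤ) * (e₃ * (j + 1)) = (e₂ * e₃) * ((i + 1) * (j + 1)) by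
          ring, abs_mul, abs_of_nonneg (by positivity : (0 : ℤ) ≤ (i + 1) * (j + 1))]
        have : |e₂ * e₃| = 1 := by
          rw [Finset.mem_insert, Finset.mem_singleton] at he₂ he₃
          rcases he₂ with rfl | rfl <;> rcases he₃ with rfl | rfl <;> rfl
        rw [this, one_mul]
      rw [hij, abs_le']
      constructor <;> nlinarith [sq_nonneg (a - b), sq_nonneg a, sq_nonneg b]
    have hm2 : m ^ 2 = (l + 1) ^ 2 := by rw [hl, mul_pow, hsq he₁, one_mul]
    have hQ' : t ^ 2 - 3 * q * t + 9 * q ^ 2 = m ^ 2 * (a ^ 2 - a * b + b ^ 2) ^ 3 := by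
      rw [hqm, htm]; ring
    refine lt_of_le_of_lt ?_ hQ
    rw [hQ', hm2]
    have : ((l + 1) ^ 2 * ((i + 1) * (j + 1)) ^ 3 : ℤ) ≤
        (l + 1) ^ 2 * (a ^ 2 - a * b + b ^ 2) ^ 3 := by gcongr
    exact_mod_cast this
  · rw [reducibleParams, ← hl, ← hi, ← hj, ← hqm, ← htm]

theorem ncard_not_isDomain_le {T : ℝ} (hT : 0 ≤ T) :
    ({p ∈ shanksParams (T ^ 4) | ¬IsDomain (ShanksRing p.1 p.2)}.ncard : ℝ) ≤
      8 * (T * (∑' n : ℕ, 1 / (n + 1 : ℝ) ^ (3 / 2 : ℝ)) ^ 2) := by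
  let E : Finset ℤ := {1, -1}
  -- The signs of m, a and b give the factor 8. Only a covering is needed, so repetitions and
  -- irrelevant triples are harmless.
  let F : Finset (ℤ × ℤ) := (E ×ˢ E ×ˢ E ×ˢ reducibleTriples T ⌈T⌉₊).image fun y =>
    reducibleParams (y.1 * (y.2.2.2.2 + 1)) (y.2.1 * (y.2.2.2.1.1 + 1))
      (y.2.2.1 * (y.2.2.2.1.2 + 1))
  have hsub : {p ∈ shanksParams (T ^ 4) | ¬IsDomain (ShanksRing p.1 p.2)} ⊆ F := by
    rintro p ⟨hp, hd⟩
    obtain ⟨e₁, he₁, e₂, he₂, e₃, he₃, x, hx, rfl⟩ :=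
      exists_reducibleParams_eq hT (Nat.le_ceil T) hp hd
    exact Finset.mem_image.2 ⟨(e₁, e₂, e₃, x), by simp only [Finset.mem_product]; tauto, rfl⟩
  have h1 := (Set.ncard_le_ncard hsub (Finset.finite_toSet F)).trans_eq (Set.ncard_coe_finset F)
  have h2 : F.card ≤ 8 * (reducibleTriples T ⌈T⌉₊).card := by
    refine Finset.card_image_le.trans_eq ?_
    have : E.card = 2 := rfl
    rw [Finset.card_product, Finset.card_product, Finset.card_product, this]
    ring
  have h3 : ({p ∈ shanksParams (T ^ 4) | ¬IsDomain (ShanksRing p.1 p.2)}.ncard : ℝ) ≤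
      8 * (reducibleTriples T ⌈T⌉₊).card := by exact_mod_cast h1.trans h2
  have h4 := card_reducibleTriples_le hT ⌈T⌉₊
  linarith

/-! ### Conclusion -/

theorem finite_c3Classes (X : ℝ) : (c3Classes X).Finite := by
  rw [c3Classes_eq_image]
  exact ((finite_shanksParams X).preimage Subtype.val_injective.injOn).image _

theorem abs_ncard_c3Classes_sub_le {T : ℝ} (hT : 1 ≤ T) :
    |((c3Classes (T ^ 4)).ncard : ℝ) - Real.pi / (6 * √3) * T ^ 2| ≤
      (3 + 8 * (∑' n : ℕ, 1 / (n + 1 : ℝ) ^ (3 / 2 : ℝ)) ^ 2) * T := by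
  have h1 := abs_ncard_shanksParams_sub_le hT
  have h2 := ncard_not_isDomain_le (zero_le_one.trans hT)
  have h3 : ((c3Classes (T ^ 4)).ncard : ℝ) +
      {p ∈ shanksParams (T ^ 4) | ¬IsDomain (ShanksRing p.1 p.2)}.ncard =
        (shanksParams (T ^ 4)).ncard := by
    rw [ncard_c3Classes, ← Nat.cast_add, Set.ncard_sep_add_ncard_sep_not (finite_shanksParams _)]
  have h4 : (0 : ℝ) ≤ {p ∈ shanksParams (T ^ 4) | ¬IsDomain (ShanksRing p.1 p.2)}.ncard :=
    Nat.cast_nonneg _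
  rw [abs_le] at h1 ⊢
  constructor <;> linarith [h1.1, h1.2]

end CubicOrder

theorem theorem1 :
    (∀ X : ℝ, (CubicOrder.c3Classes X).Finite) ∧
      (fun X : ℝ => ((CubicOrder.c3Classes X).ncard : ℝ) -
          Real.pi / (6 * Real.sqrt 3) * X ^ (1 / 2 : ℝ)) =O[atTop]
        (fun X : ℝ => X ^ (1 / 4 : ℝ)) := by
  refine ⟨CubicOrder.finite_c3Classes, IsBigO.of_bound
    (3 + 8 * (∑' n : ℕ, 1 / (n + 1 : ℝ) ^ (3 / 2 : ℝ)) ^ 2) ?_⟩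
  -- The estimate is applied with T = X^(1/4).
  filter_upwards [eventually_ge_atTop 1] with X hX
  have h0 : 0 ≤ X := zero_le_one.trans hX
  have h4 : (X ^ (1 / 4 : ℝ)) ^ 4 = X := by
    rw [← Real.rpow_natCast, ← Real.rpow_mul h0]; norm_num
  have h2 : (X ^ (1 / 4 : ℝ)) ^ 2 = X ^ (1 / 2 : ℝ) := by
    rw [← Real.rpow_natCast, ← Real.rpow_mul h0]; norm_num
  have := CubicOrder.abs_ncard_c3Classes_sub_le
    (Real.one_le_rpow hX (by norm_num : (0 : ℝ) ≤ 1 / 4))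
  rw [h4, h2] at this
  rwa [Real.norm_eq_abs, Real.norm_of_nonneg (Real.rpow_nonneg h0 _)]
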